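/- Fix countably infinite sets of attributes, constants and relation names, and let each relation name $R$ be associated with a finite set of attributes $\mathrm{Att}(R)$. Let $\mathbb{K}=(K,\oplus,0)$ be a non-trivial commutative monoid that is positive ($a\oplus b=0$ implies $a=b=0$) and weakly cancellative ($a\oplus b=b$ implies $a=0$), and write $a\le b$ if $a\oplus c=b$ for some $c\in K$. A $\mathbb{K}$-database $\mathfrak D$ over a finite set $\mathbf S$ of relation names assigns to each $R\in\mathbf S$ a finitely supported function $R^{\mathfrak D}$ from the tuples $t\colon\mathrm{Att}(R)\to\mathrm{Const}$ to $K$. For pairwise distinct $A_1,\dots,A_n\in\mathrm{Att}(R)$, put $R^{\mathfrak D}[A_1,\dots,A_n](a_1,\dots,a_n)=\bigoplus\{R^{\mathfrak D}(t) : t(A_i)=a_i \text{ for all } i\}$ (the sum over all such tuples $t$). The database is balanced if $R^{\mathfrak D}[\emptyset]=S^{\mathfrak D}[\emptyset]$ for all $R,S\in\mathbf S$. An inclusion dependency (IND) is an expression $R[A_1,\dots,A_n]\le S[B_1,\dots,B_n]$ with $n\ge 0$, pairwise distinct $A_1,\dots,A_n\in\mathrm{Att}(R)$ and pairwise distinct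 $B_1,\dots,B_n\in\mathrm{Att}(S)$; it holds in $\mathfrak D$ if $R^{\mathfrak D}[A_1,\dots,A_n](\vec a)\le S^{\mathfrak D}[B_1,\dots,B_n](\vec a)$ for all $\vec a\in\mathrm{Const}^n$. A finite set $\Sigma$ of INDs entails an IND $\tau$ over balanced $\mathbb{K}$-databases if every balanced $\mathbb{K}$-database, over any finite set of relation names containing those that occur in $\Sigma\cup\{\tau\}$, that satisfies all members of $\Sigma$ satisfies $\tau$. Consider the following inference rules. Reflexivity: $R[\vec A]\le R[\vec A]$. Transitivity: from $R[\vec A]\le S[\vec B]$ and $S[\vec B]\le T[\vec C]$ infer $R[\vec A]\le T[\vec C]$. Projection and permutation: from $R[A_1,\dots,A_n]\le S[B_1,\dots,B_n]$ infer $R[A_{i_1},\dots,A_{i_\ell}]\le S[B_{i_1},\dots,B_{i_\ell}]$ for distinct $i_1,\dots,i_\ell\in\{1,\dots,n\}$. Weak symmetry: from $R[\vec A]\le S[\vec B]$ and $S[\emptyset]\le R[\emptyset]$ infer $S[\vec B]\le R[\vec A]$. Balance: $S[\emptyset]\le R[\emptyset]$ for all relation names $R,S$. Then these rules are sound and complete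 over balanced $\mathbb{K}$-databases: for every finite set $\Sigma$ of INDs and every IND $\tau$, the IND $\tau$ is derivable from $\Sigma$ by these rules if and only if $\Sigma$ entails $\tau$ over balanced $\mathbb{K}$-databases. -/

import Mathlib

namespace KDB

/-- The natural order (a preorder) of a commutative monoid: `a ≤ b` iff `a + c = b` for some `c`. -/
def NatLE {K : Type*} [AddCommMonoid K] (a b : K) : Prop := ∃ c, a + c = b

/-- Positivity: a sum is zero only if both summands are zero. -/
def Positive (K : Type*) [AddCommMonoid K] : Prop := ∀ a b : K, a + b = 0 → a = 0 ∧ b = 0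

/-- Weak cancellativity: `a + b = b` implies `a = 0`. -/
def WeaklyCancellative (K : Type*) [AddCommMonoid K] : Prop := ∀ a b : K, a + b = b → a = 0

/-- Tuples over a finite set `X` of attributes. -/
abbrev Tup {Att : Type*} (Const : Type*) (X : Finset Att) : Type _ := X → Const

/-- `K`-relations over `X`: finitely supported functions from the tuples over `X` to `K`. -/
abbrev KRel {Att : Type*} (K Const : Type*) [AddCommMonoid K] (X : Finset Att) : Type _ :=
  Tup Const X →₀ K

/-- The marginalisation of a `K`-relation to a family `A` of attributes of `X`:
the value at `a` is the sum of the weights of all tuples `t` with `t (A i) = a i` for all `i`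
(see `marg_apply`). -/
noncomputable def marg {Att Const K ι : Type*} [AddCommMonoid K] {X : Finset Att}
    (r : KRel K Const X) (A : ι → X) : (ι → Const) →₀ K :=
  Finsupp.mapDomain (fun t i => t (A i)) r

open Classical in
theorem marg_apply {Att Const K ι : Type*} [AddCommMonoid K] {X : Finset Att}
    (r : KRel K Const X) (A : ι → X) (a : ι → Const) :
    marg r A a = ∑ t ∈ r.support with (∀ i, t (A i) = a i), r t := by
  unfold marg Finsupp.mapDomain
  rw [Finsupp.sum_apply, Finsupp.sum, Finset.sum_filter]
  refine Finset.sum_congr rfl fun t _ => ?_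
  simp [Finsupp.single_apply, funext_iff]

/-- A `K`-database over the schema `S` (a finite set of relation names): one `K`-relation over
`att R` for each `R ∈ S`. -/
def Database {Att Rel : Type*} (K Const : Type*) [AddCommMonoid K] (att : Rel → Finset Att)
    (S : Finset Rel) : Type _ :=
  (R : S) → KRel K Const (att R)

/-- A database is balanced if all its relations have the same marginal on the empty set of
attributes. -/
def Database.Balanced {Att Rel Const K : Type*} [AddCommMonoid K] {att : Rel → Finset Att}
    {S : Finset Rel} (D : Database K Const att S) : Prop :=
  ∀ R T : S, marg (D R) (Fin.elim0 : Fin 0 → att R) = marg (D T) (Fin.elim0 : Fin 0 → att T)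

/-- Inclusion dependencies `lhs[A₁,…,Aₙ] ≤ rhs[B₁,…,Bₙ]`, where the `Aᵢ` are pairwise distinct
attributes of `lhs` and the `Bᵢ` are pairwise distinct attributes of `rhs`. -/
structure IND {Att Rel : Type*} (att : Rel → Finset Att) where
  lhs : Rel
  rhs : Rel
  arity : ℕ
  A : Fin arity ↪ att lhs
  B : Fin arity ↪ att rhs

/-- Both relation names of `σ` belong to the schema `S`. -/
def IND.Over {Att Rel : Type*} {att : Rel → Finset Att} (σ : IND att) (S : Finset Rel) : Prop :=
  σ.lhs ∈ S ∧ σ.rhs ∈ S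

/-- `R[∅] ≤ T[∅]`. -/
def IND.empty {Att Rel : Type*} (att : Rel → Finset Att) (R T : Rel) : IND att :=
  ⟨R, T, 0, Function.Embedding.ofIsEmpty, Function.Embedding.ofIsEmpty⟩

/-- A database over `S` satisfies an inclusion dependency between relation names of `S`. -/
def Database.Satisfies {Att Rel Const K : Type*} [AddCommMonoid K] {att : Rel → Finset Att}
    {S : Finset Rel} (D : Database K Const att S) (σ : IND att) (h : σ.Over S) : Prop :=
  ∀ a : Fin σ.arity → Const,
    NatLE (marg (D ⟨σ.lhs, h.1⟩) σ.A a) (marg (D ⟨σ.rhs, h.2⟩) σ.B a)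

/-- Entailment over balanced `K`-databases: every balanced `K`-database, over any schema that
contains the relation names occurring in `Γ` and `τ`, satisfies `τ` if it satisfies `Γ`. -/
def BalancedEntails {Att Rel : Type*} (K Const : Type*) [AddCommMonoid K]
    {att : Rel → Finset Att} (Γ : Finset (IND att)) (τ : IND att) : Prop :=
  ∀ (S : Finset Rel) (hΓ : ∀ σ ∈ Γ, σ.Over S) (hτ : τ.Over S) (D : Database K Const att S),
    D.Balanced → (∀ (σ : IND att) (hσ : σ ∈ Γ), D.Satisfies σ (hΓ σ hσ)) → D.Satisfies τ hτ

/-- Derivability from `Γ` with the standard rules for inclusion dependencies, weak symmetry and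
the balance axioms. -/
inductive Derivable {Att Rel : Type*} {att : Rel → Finset Att} (Γ : Finset (IND att)) :
    IND att → Prop
  | hyp {σ : IND att} : σ ∈ Γ → Derivable Γ σ
  | reflexivity (R : Rel) (n : ℕ) (A : Fin n ↪ att R) : Derivable Γ ⟨R, R, n, A, A⟩
  | transitivity {R S T : Rel} {n : ℕ} {A : Fin n ↪ att R} {B : Fin n ↪ att S}
      {C : Fin n ↪ att T} :
      Derivable Γ ⟨R, S, n, A, B⟩ → Derivable Γ ⟨S, T, n, B, C⟩ → Derivable Γ ⟨R, T, n, A, C⟩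
  | projection {R S : Rel} {n l : ℕ} {A : Fin n ↪ att R} {B : Fin n ↪ att S}
      (i : Fin l ↪ Fin n) :
      Derivable Γ ⟨R, S, n, A, B⟩ → Derivable Γ ⟨R, S, l, i.trans A, i.trans B⟩
  | weakSymmetry {R S : Rel} {n : ℕ} {A : Fin n ↪ att R} {B : Fin n ↪ att S} :
      Derivable Γ ⟨R, S, n, A, B⟩ → Derivable Γ (IND.empty att S R) →
        Derivable Γ ⟨S, R, n, B, A⟩
  | balance (R S : Rel) : Derivable Γ (IND.empty att S R)

end KDB

/-!
Soundness is an induction over derivations. Derivations may pass through relation names outside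
the schema, so a database is first extended to a balanced family of relations indexed by all
relation names. A pointwise inequality `f ≤ g` of marginals amounts to an equation `f + c = g` with
`c` finitely supported (`forall_natLE_iff`); if moreover `f` and `g` have the same total, then weak
cancellativity and positivity force `c = 0` (`eq_of_forall_natLE`), which is weak symmetry.

For completeness, derivability is an equivalence relation on pairs `(T, C)`, where `C` is a sequence
of attributes of `T`: symmetry comes from weak symmetry and balance. Suppose that
`τ = R[A₁,…,Aₙ] ≤ S[B₁,…,Bₙ]` is not derivable. Multiples of a nonzero `b` copy `ℕ` with its
order into `K` (`le_of_natLE_nsmul`), so it is enough to find natural-number weights. Entries of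
tuples range over `Option (Fin n)`, with `n + 1` elements. Every relation starts with a constant
weight, scaled so that all totals agree, and receives the perturbation
`∑_C ∏ᵢ charge i (t (C i))` over all `C` with `R[A] ~ T[C]`. As `charge i = 1_{some i} - 1_{none}`
has sum zero, marginalising to attributes `E` kills all summands except those for which `C` runs
inside `E`. Hence the marginal of `T` to `E` only depends on the set of index maps `i` with
`R[A] ~ T[E ∘ i]` (`sum_fiber_weight`), and this set is the same for both sides of a derivable
dependency, by projection and transitivity. At the point `a i = some i` only `i = id` contributes:
it contributes to the marginal of `R` to `A`, but not to that of `S` to `B`, so `τ` fails.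
-/

namespace KDB

/-! ### The natural order -/

section NaturalOrder

variable {K : Type*} [AddCommMonoid K]

theorem eq_zero_of_sum_eq_zero (hpos : Positive K) {ι : Type*} (s : Finset ι) (f : ι → K)
    (h : ∑ i ∈ s, f i = 0) : ∀ i ∈ s, f i = 0 := by
  classical
  intro i hi
  rw [← Finset.add_sum_erase s f hi] at h
  exact (hpos _ _ h).1

/-- A pointwise inequality of finitely supported functions is witnessed by a finitely supported
difference, since positivity confines the difference to the support of the larger function. -/
theorem forall_natLE_iff (hpos : Positive K) {α : Type*} (f g : α →₀ K) :
    (∀ a, NatLE (f a) (g a)) ↔ ∃ c, f + c = g := by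
  constructor
  · intro h
    choose c hc using h
    refine ⟨Finsupp.onFinset g.support c fun a ha => ?_, ?_⟩
    · rw [Finsupp.mem_support_iff]
      intro h0
      exact ha (hpos _ _ ((hc a).trans h0)).2
    · ext a
      simpa using hc a
  · rintro ⟨c, rfl⟩ a
    exact ⟨c a, by simp⟩

/-- Two finitely supported functions that are comparable and have the same total are equal. -/
theorem eq_of_forall_natLE (hpos : Positive K) (hwc : WeaklyCancellative K) {α β : Type*}
    [Subsingleton β] (f g : α →₀ K) (p : α → β) (h : ∀ a, NatLE (f a) (g a))
    (htot : Finsupp.mapDomain p f = Finsupp.mapDomain p g) : f = g := by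
  obtain ⟨c, rfl⟩ := (forall_natLE_iff hpos f g).1 h
  have hc : c = 0 := by
    ext a
    by_contra ha
    rw [Finsupp.mapDomain_add] at htot
    have h0 : Finsupp.mapDomain p c (p a) = 0 := by
      refine hwc _ (Finsupp.mapDomain p f (p a)) ?_
      rw [add_comm, ← Finsupp.add_apply, ← htot]
    have hp : ∀ x, p x = p a := fun x => Subsingleton.elim _ _
    rw [Finsupp.mapDomain, Finsupp.sum_apply, Finsupp.sum] at h0
    simp only [hp, Finsupp.single_eq_same] at h0
    exact ha (eq_zero_of_sum_eq_zero hpos _ _ h0 a (Finsupp.mem_support_iff.2 ha))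
  simp [hc]

/-- The multiples of a nonzero element are ordered as the natural numbers. -/
theorem le_of_natLE_nsmul (hpos : Positive K) (hwc : WeaklyCancellative K) {b : K} (hb : b ≠ 0)
    {m n : ℕ} (h : NatLE (m • b) (n • b)) : m ≤ n := by
  by_contra! hlt
  obtain ⟨c, hc⟩ := h
  obtain ⟨k, rfl⟩ := Nat.exists_eq_add_of_lt hlt
  have h0 : b + (k • b + c) = 0 := by
    refine hwc _ (n • b) ?_
    conv_rhs => rw [← hc]
    rw [add_nsmul, add_nsmul, one_nsmul]
    abel
  exact hb (hpos _ _ h0).1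

end NaturalOrder

/-! ### Soundness -/

section Soundness

variable {Att Rel Const K : Type*} [AddCommMonoid K] {att : Rel → Finset Att}

/-- Satisfaction of a dependency in a family of relations indexed by all relation names. -/
def FamilySatisfies (D : (R : Rel) → KRel K Const (att R)) (σ : IND att) : Prop :=
  ∀ a, NatLE (marg (D σ.lhs) σ.A a) (marg (D σ.rhs) σ.B a)

theorem marg_comp {X : Finset Att} {ι κ : Type*} (r : KRel K Const X) (A : ι → X) (i : κ → ι) :
    marg r (A ∘ i) = Finsupp.mapDomain (fun a : ι → Const => a ∘ i) (marg r A) := by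
  unfold marg
  rw [← Finsupp.mapDomain_comp]
  rfl

theorem marg_fin_zero {X : Finset Att} (r : KRel K Const X) (A B : Fin 0 → X) :
    marg r A = marg r B := by
  rw [Subsingleton.elim A B]

theorem marg_elim0 {X : Finset Att} {ι : Type*} (r : KRel K Const X) (A : ι → X) :
    marg r (Fin.elim0 : Fin 0 → X) =
      Finsupp.mapDomain (fun (_ : ι → Const) (k : Fin 0) => k.elim0) (marg r A) := by
  have h := marg_comp r A (Fin.elim0 : Fin 0 → ι)
  rw [Subsingleton.elim (Fin.elim0 : Fin 0 → X) (A ∘ Fin.elim0), h]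
  congr 1
  funext a
  exact Subsingleton.elim _ _

theorem FamilySatisfies.of_derivable (hpos : Positive K) (hwc : WeaklyCancellative K)
    {Γ : Finset (IND att)} {D : (R : Rel) → KRel K Const (att R)}
    (hbal : ∀ R T, marg (D R) (Fin.elim0 : Fin 0 → att R) = marg (D T) Fin.elim0)
    (hΓ : ∀ σ ∈ Γ, FamilySatisfies D σ) {τ : IND att} (h : Derivable Γ τ) :
    FamilySatisfies D τ := by
  induction h with
  | hyp hσ => exact hΓ _ hσ
  | reflexivity R n A => exact fun a => ⟨0, add_zero _⟩
  | transitivity _ _ h₁ h₂ =>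
    intro a
    obtain ⟨c, hc⟩ := h₁ a
    obtain ⟨d, hd⟩ := h₂ a
    exact ⟨c + d, by rw [← add_assoc, hc]; exact hd⟩
  | projection i _ h =>
    obtain ⟨c, hc⟩ := (forall_natLE_iff hpos _ _).1 h
    refine (forall_natLE_iff hpos _ _).2 ?_
    simp only [Function.Embedding.coe_trans, marg_comp]
    exact ⟨Finsupp.mapDomain (fun a => a ∘ i) c, by rw [← hc, Finsupp.mapDomain_add]⟩
  | weakSymmetry _ _ h _ =>
    have heq := eq_of_forall_natLE hpos hwc _ _
      (fun (_ : _ → Const) (k : Fin 0) => (k.elim0 : Const)) h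
      (by rw [← marg_elim0, ← marg_elim0]; exact hbal _ _)
    intro a
    exact ⟨0, by rw [add_zero]; exact (DFunLike.congr_fun heq a).symm⟩
  | balance R S =>
    intro a
    refine ⟨0, ?_⟩
    rw [add_zero]
    exact DFunLike.congr_fun
      (((marg_fin_zero _ _ _).trans (hbal S R)).trans (marg_fin_zero _ _ _)) a

/-- The derivation may use relation names outside the schema; they are interpreted by relations
with a single tuple, whose weight is the common total of the database. -/
theorem sound [Nonempty Const] (hpos : Positive K) (hwc : WeaklyCancellative K)
    {Γ : Finset (IND att)} {τ : IND att} (h : Derivable Γ τ) : BalancedEntails K Const Γ τ := by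
  classical
  intro S hΓ hτ D hbal hD
  let x : Const := Classical.arbitrary Const
  let k : K := marg (D ⟨τ.lhs, hτ.1⟩) (Fin.elim0 : Fin 0 → att τ.lhs) Fin.elim0
  let D' : (R : Rel) → KRel K Const (att R) := fun R =>
    if hR : R ∈ S then D ⟨R, hR⟩ else Finsupp.single (fun _ => x) k
  have hD' : ∀ R (hR : R ∈ S), D' R = D ⟨R, hR⟩ := fun R hR => dif_pos hR
  have htot : ∀ R, marg (D' R) (Fin.elim0 : Fin 0 → att R) =
      marg (D ⟨τ.lhs, hτ.1⟩) (Fin.elim0 : Fin 0 → att τ.lhs) := by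
    intro R
    by_cases hR : R ∈ S
    · rw [hD' R hR]
      exact hbal ⟨R, hR⟩ ⟨τ.lhs, hτ.1⟩
    · have : D' R = Finsupp.single (fun _ => x) k := dif_neg hR
      rw [this]
      refine Finsupp.ext fun a => ?_
      rw [marg, Finsupp.mapDomain_single, Subsingleton.elim a Fin.elim0,
        Subsingleton.elim (fun _ : Fin 0 => x) Fin.elim0, Finsupp.single_eq_same]
  have hs := FamilySatisfies.of_derivable hpos hwc (D := D')
    (fun R T => (htot R).trans (htot T).symm)
    (fun σ hσ a => by
      rw [hD' _ (hΓ σ hσ).1, hD' _ (hΓ σ hσ).2]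
      exact hD σ hσ a) h
  intro a
  have ha := hs a
  rwa [hD' _ hτ.1, hD' _ hτ.2] at ha

end Soundness

/-! ### Perturbed uniform weights -/

section Weights

variable {X : Type*} {n m : ℕ}

/-- The function `1_{some j} - 1_{none}`, which has sum zero. -/
def charge (j : Fin n) (x : Option (Fin n)) : ℤ :=
  if x = some j then 1 else if x = none then -1 else 0

theorem charge_swap (j : Fin n) (x : Option (Fin n)) :
    charge j (Equiv.swap (some j) none x) = -charge j x := by
  unfold charge
  by_cases h : x = some j
  · simp [h]
  · by_cases h' : x = none
    · simp [h']
    · simp [Equiv.swap_apply_of_ne_of_ne h h', h, h']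

theorem abs_charge_le_one (j : Fin n) (x : Option (Fin n)) : |charge j x| ≤ 1 := by
  unfold charge
  split_ifs <;> simp

/-- The product of the charges of the entries of `t` at the attributes `C`. -/
def chargeProd (C : Fin n → X) (t : X → Option (Fin n)) : ℤ := ∏ i, charge i (t (C i))

theorem neg_one_le_chargeProd (C : Fin n → X) (t : X → Option (Fin n)) : -1 ≤ chargeProd C t := by
  refine (abs_le.1 ?_).1
  rw [chargeProd, Finset.abs_prod]
  exact Finset.prod_le_one (fun _ _ => abs_nonneg _) fun i _ => abs_charge_le_one i _

theorem sum_fiber_chargeProd_eq_zero [Fintype X] [DecidableEq X] (E : Fin m → X) (a : Fin m → Option (Fin n))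
    (C : Fin n ↪ X) {j : Fin n} (hj : C j ∉ Set.range E) :
    ∑ t with t ∘ E = a, chargeProd C t = 0 := by
  -- Exchanging `some j` and `none` in the entry at `C j` permutes the fiber and changes the sign.
  let e : (X → Option (Fin n)) → X → Option (Fin n) := fun t =>
    Function.update t (C j) (Equiv.swap (some j) none (t (C j)))
  have he : ∀ t, e (e t) = t := fun t => by simp [e]
  have hE : ∀ t, e t ∘ E = t ∘ E := by
    intro t
    funext i
    have : E i ≠ C j := fun h => hj ⟨i, h⟩
    simp [e, this]
  have hneg : ∀ t, chargeProd C (e t) = -chargeProd C t := by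
    intro t
    unfold chargeProd
    rw [← Finset.mul_prod_erase _ _ (Finset.mem_univ j),
      ← Finset.mul_prod_erase _ (fun i => charge i (t (C i))) (Finset.mem_univ j), ← neg_mul]
    congr 1
    · simp [e, charge_swap]
    · refine Finset.prod_congr rfl fun i hi => ?_
      have : C i ≠ C j := C.injective.ne (Finset.ne_of_mem_erase hi)
      simp [e, this]
  have hsum : ∑ t with t ∘ E = a, chargeProd C t = ∑ t with t ∘ E = a, -chargeProd C t :=
    Finset.sum_nbij' e e (by simp [hE]) (by simp [hE]) (by simp [he]) (by simp [he])
      (by simp [hneg])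
  rw [Finset.sum_neg_distrib] at hsum
  omega

theorem card_fiber [Fintype X] [DecidableEq X] {D : Type*} [Fintype D] [DecidableEq D] (E : Fin m ↪ X) (a : Fin m → D) :
    (Finset.univ.filter fun t : X → D => t ∘ E = a).card =
      Fintype.card D ^ (Fintype.card X - m) := by
  have : (Finset.univ.filter fun t : X → D => t ∘ E = a) =
      Fintype.piFinset fun x => if h : ∃ i, E i = x then {a h.choose} else Finset.univ := by
    ext t
    simp only [Finset.mem_filter, Finset.mem_univ, true_and, Fintype.mem_piFinset]
    constructor
    · rintro rfl x
      split_ifs with h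
      · simp [h.choose_spec]
      · simp
    · intro h
      funext i
      have hi := h (E i)
      have hex : ∃ k, E k = E i := ⟨i, rfl⟩
      rw [dif_pos hex, Finset.mem_singleton, E.injective hex.choose_spec] at hi
      exact hi
  rw [this, Fintype.card_piFinset]
  have hc : ∀ x, (if h : ∃ i, E i = x then {a h.choose} else (Finset.univ : Finset D)).card =
      if ∃ i, E i = x then 1 else Fintype.card D := by
    intro x
    split_ifs <;> simp
  simp only [hc]
  rw [Finset.prod_ite, Finset.prod_const_one, one_mul, Finset.prod_const]
  congr 1
  have hr : (Finset.univ.filter fun x => ∃ i, E i = x).card = m := by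
    have : (Finset.univ.filter fun x => ∃ i, E i = x) = Finset.univ.map E := by
      ext x
      simp
    simp [this]
  have := Finset.card_filter_add_card_filter_not (s := (Finset.univ : Finset X))
    (fun x => ∃ i, E i = x)
  rw [hr, Finset.card_univ] at this
  omega

/-- The constant weight `N`, perturbed by the charge products along the sequences in `P`. -/
def weight (N : ℕ) (P : Finset (Fin n ↪ X)) (t : X → Option (Fin n)) : ℤ :=
  N + ∑ C ∈ P, chargeProd C t

theorem weight_nonneg {N : ℕ} {P : Finset (Fin n ↪ X)} (h : P.card ≤ N)
    (t : X → Option (Fin n)) : 0 ≤ weight N P t := by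
  have := Finset.card_nsmul_le_sum P (fun C => chargeProd C t) (-1)
    fun C _ => neg_one_le_chargeProd C t
  simp only [nsmul_eq_mul] at this
  unfold weight
  omega

open Classical in
/-- The marginal of a perturbed weight is, up to scaling, the perturbed weight along those
sequences of indices which `E` carries into `P`. -/
theorem sum_fiber_weight [Fintype X] [DecidableEq X] (N : ℕ) (P : Finset (Fin n ↪ X)) (E : Fin m ↪ X)
    (a : Fin m → Option (Fin n)) :
    ∑ t with t ∘ E = a, weight N P t =
      ((n + 1) ^ (Fintype.card X - m) : ℕ) *
        weight N (Finset.univ.filter fun i : Fin n ↪ Fin m => i.trans E ∈ P) a := by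
  unfold weight
  rw [Finset.sum_add_distrib, Finset.sum_const, card_fiber, Finset.sum_comm, mul_add,
    Fintype.card_option, Fintype.card_fin, nsmul_eq_mul, Finset.mul_sum]
  congr 1
  symm
  refine Finset.sum_of_injOn (fun i : Fin n ↪ Fin m => i.trans E) ?_ ?_ ?_ ?_
  · intro i _ k _ h
    ext x
    have := DFunLike.congr_fun h x
    exact congrArg Fin.val (E.injective this)
  · intro i hi
    simpa using hi
  · intro C hC hi
    -- A sequence inside the range of `E` factors through `E`.
    by_cases h : ∀ j, C j ∈ Set.range E
    · exfalso
      choose i hi' using h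
      have hinj : Function.Injective i := fun x y hxy => C.injective (by
        rw [← hi' x, ← hi' y, hxy])
      have hE : Function.Embedding.trans ⟨i, hinj⟩ E = C := DFunLike.ext _ _ hi'
      exact hi ⟨⟨i, hinj⟩, by simpa [hE] using hC, hE⟩
    · push Not at h
      obtain ⟨j, hj⟩ := h
      exact sum_fiber_chargeProd_eq_zero E a C hj
  · intro i _
    have : ∀ t ∈ Finset.univ.filter (fun t : X → Option (Fin n) => t ∘ E = a),
        chargeProd (i.trans E) t = chargeProd i a := by
      intro t ht
      rw [← (Finset.mem_filter.1 ht).2]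
      rfl
    rw [Finset.sum_congr rfl this, Finset.sum_const, card_fiber, Fintype.card_option,
      Fintype.card_fin, nsmul_eq_mul]

theorem chargeProd_some (i : Fin n ↪ Fin n) :
    chargeProd i (fun k => some k) = if i = Function.Embedding.refl _ then 1 else 0 := by
  split_ifs with h
  · subst h
    simp [chargeProd, charge]
  · obtain ⟨k, hk⟩ : ∃ k, i k ≠ k := by
      by_contra! hc
      exact h (by ext k; simp [hc])
    exact Finset.prod_eq_zero (Finset.mem_univ k) (by simp [charge, hk])

theorem weight_some (N : ℕ) (P : Finset (Fin n ↪ Fin n)) :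
    weight N P (fun k => some k) = N + if Function.Embedding.refl _ ∈ P then 1 else 0 := by
  classical
  simp [weight, chargeProd_some]

end Weights

/-! ### The counterexample database -/

section Counterexample

variable {Att Rel Const K : Type*} [AddCommMonoid K] {att : Rel → Finset Att}

/-- The relation with weights `(n+1)^(L-|X|) * weight N P t` on the tuples with entries in (the copy
under `e` of) `Option (Fin n)`, as multiples of `b`. The power makes the total independent of `X`. -/
noncomputable def weightRel {X : Finset Att} {n : ℕ} (e : Option (Fin n) → Const) (b : K)
    (L N : ℕ) (P : Finset (Fin n ↪ X)) : KRel K Const X :=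
  Finsupp.mapDomain (fun t : X → Option (Fin n) => e ∘ t)
    (Finsupp.equivFunOnFinite.symm fun t =>
      ((n + 1) ^ (L - X.card) * (weight N P t).toNat) • b)

theorem mapDomain_equivFunOnFinite_symm {α β : Type*} [Fintype α] [Finite β]
    [DecidableEq β] (p : α → β) (f : α → K) :
    Finsupp.mapDomain p (Finsupp.equivFunOnFinite.symm f) =
      Finsupp.equivFunOnFinite.symm fun y => ∑ x with p x = y, f x := by
  ext y
  rw [Finsupp.mapDomain, Finsupp.sum_fintype _ _ (by simp), Finsupp.finsetSum_apply]
  simp [Finsupp.single_apply, Finset.sum_filter]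

open Classical in
theorem marg_weightRel {X : Finset Att} {n m : ℕ} (e : Option (Fin n) → Const) (b : K)
    {L N : ℕ} {P : Finset (Fin n ↪ X)} (hL : X.card ≤ L) (hN : P.card ≤ N) (E : Fin m ↪ X) :
    marg (weightRel e b L N P) E =
      Finsupp.mapDomain (fun a : Fin m → Option (Fin n) => e ∘ a)
        (Finsupp.equivFunOnFinite.symm fun a => ((n + 1) ^ (L - m) *
          (weight N (Finset.univ.filter fun i : Fin n ↪ Fin m => i.trans E ∈ P) a).toNat) • b) := by
  have hm : m ≤ X.card := by simpa using Fintype.card_le_of_embedding E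
  have hcomm : marg (weightRel e b L N P) E =
      Finsupp.mapDomain (fun a : Fin m → Option (Fin n) => e ∘ a)
        (Finsupp.mapDomain (fun t : X → Option (Fin n) => t ∘ E)
          (Finsupp.equivFunOnFinite.symm fun t =>
            ((n + 1) ^ (L - X.card) * (weight N P t).toNat) • b)) := by
    rw [marg, weightRel, ← Finsupp.mapDomain_comp, ← Finsupp.mapDomain_comp]
    rfl
  rw [hcomm, mapDomain_equivFunOnFinite_symm]
  congr 2
  funext a
  rw [← Finset.sum_smul, ← Finset.mul_sum]
  congr 1
  have key := sum_fiber_weight N P E a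
  have hs : ∑ t with t ∘ E = a, (weight N P t).toNat = (n + 1) ^ (X.card - m) *
      (weight N (Finset.univ.filter fun i : Fin n ↪ Fin m => i.trans E ∈ P) a).toNat := by
    have hcard : (Finset.univ.filter fun i : Fin n ↪ Fin m => i.trans E ∈ P).card ≤ N := by
      refine le_trans (Finset.card_le_card_of_injOn (fun i => i.trans E) (fun i hi => ?_) ?_) hN
      · simpa using hi
      · intro i _ k _ h
        ext x
        exact congrArg Fin.val (E.injective (DFunLike.congr_fun h x))
    zify
    rw [Int.toNat_of_nonneg (weight_nonneg hcard a),
      Finset.sum_congr rfl fun t _ => Int.toNat_of_nonneg (weight_nonneg hN t)]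
    simpa using key
  rw [hs, ← mul_assoc, ← pow_add]
  congr 3
  omega

end Counterexample

/-! ### Completeness -/

section Completeness

variable {Att Rel Const K : Type*} [AddCommMonoid K] {att : Rel → Finset Att}

theorem Derivable.symm {Γ : Finset (IND att)} {R S : Rel} {n : ℕ} {A : Fin n ↪ att R}
    {B : Fin n ↪ att S} (h : Derivable Γ ⟨R, S, n, A, B⟩) : Derivable Γ ⟨S, R, n, B, A⟩ :=
  .weakSymmetry h (.balance R S)

theorem complete [Nontrivial K] [Infinite Const] (hpos : Positive K)
    (hwc : WeaklyCancellative K) {Γ : Finset (IND att)} {τ : IND att}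
    (h : BalancedEntails K Const Γ τ) : Derivable Γ τ := by
  classical
  obtain ⟨b, hb⟩ := exists_ne (0 : K)
  obtain ⟨R, T, n, A, B⟩ := τ
  let e : Option (Fin n) ↪ Const := (Fintype.equivFin _).toEmbedding.trans
    (Fin.valEmbedding.trans (Infinite.natEmbedding Const))
  let S : Finset Rel := insert R (insert T (Γ.image IND.lhs ∪ Γ.image IND.rhs))
  let L : ℕ := S.sup fun U => (att U).card
  let N : ℕ := S.sup fun U => Fintype.card (Fin n ↪ att U)
  let P : (U : Rel) → Finset (Fin n ↪ att U) := fun U =>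
    Finset.univ.filter fun C => Derivable Γ ⟨R, U, n, A, C⟩
  let D : Database K Const att S := fun U => weightRel e b L N (P U)
  have hL : ∀ U : S, (att U).card ≤ L := fun U =>
    Finset.le_sup (f := fun U => (att U).card) U.2
  have hN : ∀ U : S, (P U).card ≤ N := fun U =>
    (Finset.card_le_univ _).trans
      (Finset.le_sup (f := fun U => Fintype.card (Fin n ↪ att U)) U.2)
  have hmarg : ∀ {m : ℕ} (U V : S) (E : Fin m ↪ att U) (F : Fin m ↪ att V),
      Derivable Γ ⟨U, V, m, E, F⟩ → marg (D U) E = marg (D V) F := by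
    intro m U V E F hEF
    rw [marg_weightRel e b (hL U) (hN U), marg_weightRel e b (hL V) (hN V)]
    have : ∀ i : Fin n ↪ Fin m, i.trans E ∈ P U ↔ i.trans F ∈ P V := by
      intro i
      simp only [P, Finset.mem_filter, Finset.mem_univ, true_and]
      exact ⟨fun hi => hi.transitivity (hEF.projection i),
        fun hi => hi.transitivity (hEF.projection i).symm⟩
    simp only [this]
  have hτ : IND.Over ⟨R, T, n, A, B⟩ S := by simp [IND.Over, S]
  have hsat := h S
    (fun σ hσ => ⟨by
      simp only [S, Finset.mem_insert, Finset.mem_union, Finset.mem_image]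
      exact .inr (.inr (.inl ⟨σ, hσ, rfl⟩)), by
      simp only [S, Finset.mem_insert, Finset.mem_union, Finset.mem_image]
      exact .inr (.inr (.inr ⟨σ, hσ, rfl⟩))⟩) hτ D
    (fun U V => by
      have := hmarg U V _ _ (.balance V.1 U.1)
      convert this)
    (fun σ hσ a => ⟨0, by
      rw [add_zero]
      exact DFunLike.congr_fun (hmarg ⟨σ.lhs, _⟩ ⟨σ.rhs, _⟩ σ.A σ.B (.hyp hσ)) a⟩)
    (fun k => e (some k))
  -- At the tuple with `k`-th entry (the copy of) `some k` the two marginals differ exactly if `τ`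
  -- is not derivable.
  have hval : ∀ (U : S) (E : Fin n ↪ att U), marg (D U) E (fun k => e (some k)) =
      ((n + 1) ^ (L - n) * (N + if E ∈ P U then 1 else 0)) • b := by
    intro U E
    have hinj : Function.Injective fun a : Fin n → Option (Fin n) => e ∘ a :=
      e.injective.comp_left
    rw [marg_weightRel e b (hL U) (hN U)]
    refine (Finsupp.mapDomain_apply hinj _ fun k => some k).trans ?_
    simp only [Finsupp.equivFunOnFinite_symm_apply_apply, weight_some, Finset.mem_filter,
      Finset.mem_univ, true_and]
    have : (Function.Embedding.refl (Fin n)).trans E = E := rfl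
    rw [this]
    congr 2
    split_ifs <;> simp
  rw [hval ⟨R, hτ.1⟩ A, hval ⟨T, hτ.2⟩ B] at hsat
  have hle := Nat.le_of_mul_le_mul_left (le_of_natLE_nsmul hpos hwc hb hsat) (by positivity)
  have hA : A ∈ P R := by
    simp only [P, Finset.mem_filter, Finset.mem_univ, true_and]
    exact .reflexivity R n A
  rw [if_pos hA] at hle
  by_cases hB : B ∈ P T
  · exact (Finset.mem_filter.1 hB).2
  · rw [if_neg hB] at hle
    omega

end Completeness

end KDB

theorem mainTheorem7 {K Att Const Rel : Type*} [AddCommMonoid K] [Nontrivial K]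
    (hpos : KDB.Positive K) (hwc : KDB.WeaklyCancellative K)
    [Countable Att] [Infinite Att] [Countable Const] [Infinite Const]
    [Countable Rel] [Infinite Rel] (att : Rel → Finset Att) :
    -- soundness
    (∀ (Γ : Finset (KDB.IND att)) (τ : KDB.IND att),
      KDB.Derivable Γ τ → KDB.BalancedEntails K Const Γ τ) ∧
    -- completeness
    (∀ (Γ : Finset (KDB.IND att)) (τ : KDB.IND att),
      KDB.BalancedEntails K Const Γ τ → KDB.Derivable Γ τ) :=
  ⟨fun _ _ => KDB.sound hpos hwc, fun _ _ => KDB.complete hpos hwc⟩
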